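/- Let $1\le r<d$ be integers and let $G\in\mathbb{R}^{d\times d}$ be a symmetric positive semidefinite matrix with a spectral decomposition $G=U\Lambda U^\top$, where $U=(u_1,\dots,u_d)$ is orthogonal, $\Lambda=\operatorname{diag}(\lambda_1,\dots,\lambda_d)$ and $\lambda_1\ge\dots\ge\lambda_d\ge 0$. Let $s$ be a random vector uniformly distributed on the unit sphere $S^{d-1}\subset\mathbb{R}^d$, and put $Y=U^\top s$ and $\kappa=s^\top G s$. Let $P_{U_r}$ be the orthogonal projection onto $U_r=\operatorname{span}\{u_1,\dots,u_r\}$. Then: (1) $\kappa=s^\top G s=\sum_{i=1}^d\lambda_iY_i^2$, and $Y$ is again uniformly distributed on $S^{d-1}$. (2) The energy in the leading $r$-dimensional subspace satisfies $\|P_{U_r}s\|_2^2=\sum_{i=1}^rY_i^2\sim\mathrm{Beta}\left(\frac r2,\frac{d-r}2\right)$. (3) If the trailing part is negligible with high probability, then $\kappa$ is approximated by its leading part: for all real $\varepsilon,\delta\ge 0$, if $$\mathbb{P}\Big(\sum_{i=r+1}^d\lambda_iY_i^2\le\varepsilon\sum_{i=1}^r\lambda_iY_i^2\Big)\ge 1-\delta,$$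 then $$\mathbb{P}\Big(\Big|\kappa-\sum_{i=1}^r\lambda_iY_i^2\Big|\le\varepsilon\sum_{i=1}^r\lambda_iY_i^2\Big)\ge 1-\delta.$$ -/

import Mathlib

open MeasureTheory ProbabilityTheory
open scoped Matrix

/-- The uniform distribution on the unit sphere of `ℝ^d` (Euclidean norm), as a measure on `ℝ^d`:
the surface measure of the sphere, normalized to total mass one. -/
noncomputable def unifSphere (d : ℕ) : Measure (EuclideanSpace ℝ (Fin d)) :=
  Measure.map (Subtype.val : Metric.sphere (0 : EuclideanSpace ℝ (Fin d)) 1 → _)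
    (((volume : Measure (EuclideanSpace ℝ (Fin d))).toSphere Set.univ)⁻¹ •
      (volume : Measure (EuclideanSpace ℝ (Fin d))).toSphere)

/-- The quadratic form `xᵀ G x`; on unit vectors `x` it is the Rayleigh quotient of `G`. -/
noncomputable def quadForm {d : ℕ} (G : Matrix (Fin d) (Fin d) ℝ)
    (x : EuclideanSpace ℝ (Fin d)) : ℝ :=
  x.ofLp ⬝ᵥ (G *ᵥ x.ofLp)

/-- The rotated vector `Uᵀ x`. -/
noncomputable def rotated {d : ℕ} (U : Matrix (Fin d) (Fin d) ℝ)
    (x : EuclideanSpace ℝ (Fin d)) : EuclideanSpace ℝ (Fin d) :=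
  WithLp.toLp 2 (Uᵀ *ᵥ x.ofLp)

/-- The span of the first `r` columns `u_1, …, u_r` of `U`. -/
noncomputable def leadingSpan {d : ℕ} (U : Matrix (Fin d) (Fin d) ℝ) (r : ℕ) :
    Submodule ℝ (EuclideanSpace ℝ (Fin d)) :=
  Submodule.span ℝ ((fun i : Fin d => WithLp.toLp 2 (U.col i)) '' {i | (i : ℕ) < r})

open scoped ENNReal
open Set

/-! Up to a constant, the uniform law on the sphere is the image of Lebesgue measure on the unit
ball under `x ↦ ‖x‖⁻¹ • x` (`exists_unifSphere_eq_smul_map`). Volume, ball and normalization all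
respect linear isometries, hence rotation invariance. For the Beta law, split the coordinates into
`r` and `d - r`: under Lebesgue measure the squared block norms `u`, `v` have densities proportional
to `u ^ (r/2 - 1)` and `v ^ ((d-r)/2 - 1)`, and the substitution `s = u + v`, `t = u / s` separates
the ball constraint `s < 1` from the ratio `t`, whose density is the Beta one
(`lintegral_lintegral_posPow`). Constants are not computed: total mass one fixes the last of them.
Part (3) holds because the error is exactly the trailing sum, which is nonnegative. -/

/-- The power function on the positive half-line, extended by zero. -/
noncomputable def posPow (p : ℝ) : ℝ → ℝ≥0∞ :=
  indicator (Ioi 0) fun u => ENNReal.ofReal (u ^ p)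

lemma posPow_of_pos (p : ℝ) {u : ℝ} (hu : 0 < u) : posPow p u = ENNReal.ofReal (u ^ p) :=
  indicator_of_mem (mem_Ioi.2 hu) _

lemma posPow_of_nonpos (p : ℝ) {u : ℝ} (hu : u ≤ 0) : posPow p u = 0 :=
  indicator_of_notMem (by simpa using hu) _

lemma measurable_posPow (p : ℝ) : Measurable (posPow p) :=
  Measurable.indicator (by fun_prop) measurableSet_Ioi

/-- Extension by zero makes this valid for every `t`, so rescaling needs no domain bookkeeping. -/
lemma posPow_mul (p : ℝ) {s : ℝ} (hs : 0 < s) (t : ℝ) :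
    posPow p (s * t) = posPow p s * posPow p t := by
  rcases le_or_gt t 0 with ht | ht
  · rw [posPow_of_nonpos p ht, posPow_of_nonpos p (mul_nonpos_of_nonneg_of_nonpos hs.le ht),
      mul_zero]
  · rw [posPow_of_pos p hs, posPow_of_pos p ht, posPow_of_pos p (mul_pos hs ht),
      Real.mul_rpow hs.le ht.le, ENNReal.ofReal_mul (by positivity)]

lemma lintegral_comp_mul_left_of_pos {s : ℝ} (hs : 0 < s) {f : ℝ → ℝ≥0∞} (hf : Measurable f) :
    ∫⁻ u, f u = ENNReal.ofReal s * ∫⁻ t, f (s * t) := by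
  conv_lhs => rw [← Real.smul_map_volume_mul_left hs.ne']
  rw [lintegral_smul_measure, lintegral_map hf (by fun_prop), abs_of_pos hs, smul_eq_mul]

lemma lintegral_lintegral_posPow (p q : ℝ) {W F : ℝ → ℝ≥0∞} (hW : Measurable W)
    (hF : Measurable F) :
    ∫⁻ u, ∫⁻ v, posPow p u * posPow q v * (W (u + v) * F (u / (u + v))) =
      (∫⁻ s, W s * (ENNReal.ofReal s * posPow p s * posPow q s)) *
        ∫⁻ t, posPow p t * posPow q (1 - t) * F t := by
  have hp := measurable_posPow p
  have hq := measurable_posPow q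
  calc
    _ = ∫⁻ u, ∫⁻ s, posPow p u * posPow q (s - u) * (W s * F (u / s)) := by
      refine lintegral_congr fun u => ?_
      rw [← lintegral_sub_right_eq_self _ u]
      simp
    _ = ∫⁻ s, ∫⁻ u, posPow p u * posPow q (s - u) * (W s * F (u / s)) :=
      lintegral_lintegral_swap (by fun_prop)
    _ = ∫⁻ s, W s * (ENNReal.ofReal s * posPow p s * posPow q s) *
          ∫⁻ t, posPow p t * posPow q (1 - t) * F t := by
      refine lintegral_congr fun s => ?_
      rcases le_or_gt s 0 with hs | hs
      -- For `s ≤ 0`, one of `u` and `s - u` is nonpositive, so the integrand vanishes.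
      · rw [posPow_of_nonpos p hs, mul_zero, zero_mul, mul_zero, zero_mul]
        refine lintegral_eq_zero_of_ae_eq_zero (.of_forall fun u => ?_)
        rcases le_or_gt u 0 with hu | hu
        · simp [posPow_of_nonpos p hu]
        · simp [posPow_of_nonpos q (by linarith : s - u ≤ 0)]
      · rw [lintegral_comp_mul_left_of_pos hs (by fun_prop),
          ← lintegral_const_mul _ (by fun_prop), ← lintegral_const_mul _ (by fun_prop)]
        refine lintegral_congr fun t => ?_
        rw [mul_div_cancel_left₀ _ hs.ne', posPow_mul p hs,
          show s - s * t = s * (1 - t) by ring, posPow_mul q hs]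
        ring
    _ = _ := lintegral_mul_const _ (by fun_prop)

lemma betaMeasure_eq_smul (a b : ℝ) (ha : 0 < a) (hb : 0 < b) :
    betaMeasure a b = ENNReal.ofReal (1 / beta a b) •
      volume.withDensity fun t => posPow (a - 1) t * posPow (b - 1) (1 - t) := by
  have hp := measurable_posPow (a - 1)
  have hq := measurable_posPow (b - 1)
  rw [betaMeasure, ← withDensity_smul _ (by fun_prop)]
  congr 1
  ext t
  have hβ := beta_pos ha hb
  rcases le_or_gt t 0 with h0 | h0
  · simp [betaPDF_eq_zero_of_nonpos h0, posPow_of_nonpos _ h0]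
  rcases le_or_gt 1 t with h1 | h1
  · simp [betaPDF_eq_zero_of_one_le h1, posPow_of_nonpos _ (by linarith : 1 - t ≤ 0)]
  have h1' : 0 < 1 - t := by linarith
  rw [betaPDF_of_pos_lt_one h0 h1, Pi.smul_apply, posPow_of_pos _ h0, posPow_of_pos _ h1',
    smul_eq_mul, ENNReal.ofReal_mul (by positivity), ENNReal.ofReal_mul (by positivity), mul_assoc]

/-! ### Density of the squared norm, by polar coordinates -/

lemma exists_lintegral_norm_sq (E : Type*) [NormedAddCommGroup E] [InnerProductSpace ℝ E]
    [MeasurableSpace E] [BorelSpace E] [FiniteDimensional ℝ E] [Nontrivial E] :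
    ∃ c : ℝ≥0∞, ∀ f : ℝ → ℝ≥0∞, Measurable f →
      ∫⁻ x : E, f (‖x‖ ^ 2) = c * ∫⁻ u, posPow (Module.finrank ℝ E / 2 - 1) u * f u := by
  -- The factor `1 / 2` comes from `u = r ^ 2`, `du = 2 r dr`.
  refine ⟨(volume : Measure E).toSphere univ * ENNReal.ofReal (1 / 2), fun f hf => ?_⟩
  set n := Module.finrank ℝ E with hn
  have hn0 : 0 < n := Module.finrank_pos
  have hp := measurable_posPow (n / 2 - 1)
  have hpolar : ∫⁻ x : E, f (‖x‖ ^ 2) = (volume : Measure E).toSphere univ *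
      ∫⁻ r in Ioi (0 : ℝ), ENNReal.ofReal (r ^ (n - 1)) * f (r ^ 2) := by
    calc
      _ = ∫⁻ x : ({(0)}ᶜ : Set E), f (‖(x : E)‖ ^ 2) ∂((volume : Measure E).comap Subtype.val) := by
        rw [lintegral_subtype_comap (measurableSet_singleton _).compl fun x : E => f (‖x‖ ^ 2),
          restrict_compl_singleton]
      _ = ∫⁻ x, f (x.2.1 ^ 2) ∂(volume : Measure E).toSphere.prod (.volumeIoiPow (n - 1)) := by
        simpa using (volume : Measure E).measurePreserving_homeomorphUnitSphereProd.lintegral_comp_emb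
          (Homeomorph.measurableEmbedding _)
          (fun x : Metric.sphere (0 : E) 1 × Ioi (0 : ℝ) => f (x.2.1 ^ 2))
      _ = (volume : Measure E).toSphere univ *
          ∫⁻ r : Ioi (0 : ℝ), f (r.1 ^ 2) ∂.volumeIoiPow (n - 1) := by
        rw [lintegral_prod _ (by fun_prop), mul_comm]
        exact lintegral_const (∫⁻ r : Ioi (0 : ℝ), f (r.1 ^ 2) ∂.volumeIoiPow (n - 1))
      _ = _ := by
        rw [Measure.volumeIoiPow, lintegral_withDensity_eq_lintegral_mul _ (by fun_prop)
          (by fun_prop), ← lintegral_subtype_comap measurableSet_Ioi]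
        rfl
  have himg : (fun r : ℝ => r ^ 2) '' Ioi 0 = Ioi 0 := by
    ext u
    constructor
    · rintro ⟨r, hr, rfl⟩
      exact pow_pos (mem_Ioi.1 hr) 2
    · intro hu
      exact ⟨√u, Real.sqrt_pos.2 hu, Real.sq_sqrt (mem_Ioi.1 hu).le⟩
  have hsub : ∫⁻ u, posPow (n / 2 - 1) u * f u =
      ENNReal.ofReal 2 * ∫⁻ r in Ioi (0 : ℝ), ENNReal.ofReal (r ^ (n - 1)) * f (r ^ 2) := by
    have h0 : ∫⁻ u, posPow (n / 2 - 1) u * f u =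
        ∫⁻ u in Ioi 0, posPow (n / 2 - 1) u * f u := by
      rw [← lintegral_indicator measurableSet_Ioi]
      refine lintegral_congr fun u => ?_
      by_cases hu : 0 < u
      · rw [indicator_of_mem (mem_Ioi.2 hu)]
      · rw [indicator_of_notMem (by simpa using hu), posPow_of_nonpos _ (not_lt.1 hu), zero_mul]
    rw [h0]
    conv_lhs => rw [← himg]
    rw [lintegral_image_eq_lintegral_deriv_mul_of_monotoneOn measurableSet_Ioi
      (f' := fun r => 2 * r) (fun r _ => by simpa using (hasDerivAt_pow 2 r).hasDerivWithinAt)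
      (fun x hx y _ hxy => pow_le_pow_left₀ (mem_Ioi.1 hx).le hxy 2),
      ← lintegral_const_mul _ (by fun_prop)]
    refine setLIntegral_congr_fun measurableSet_Ioi fun r hr => ?_
    have hr : 0 < r := hr
    rw [posPow_of_pos _ (by positivity), ← mul_assoc, ← mul_assoc,
      ← ENNReal.ofReal_mul (by positivity), ← ENNReal.ofReal_mul (by positivity), mul_assoc 2]
    congr 3
    rw [← Real.rpow_natCast r 2, ← Real.rpow_mul hr.le, ← Real.rpow_natCast r (n - 1),
      Nat.cast_sub hn0]
    nth_rewrite 1 [← Real.rpow_one r]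
    rw [← Real.rpow_add hr]
    congr 1
    push_cast
    ring
  rw [hpolar, hsub, mul_assoc, ← mul_assoc (ENNReal.ofReal _), ← ENNReal.ofReal_mul (by norm_num)]
  norm_num

/-! ### The uniform measure seen from the ball -/

open scoped Pointwise in
lemma exists_unifSphere_eq_smul_map (d : ℕ) (hd : 0 < d) :
    ∃ c : ℝ≥0∞, unifSphere d = c • Measure.map (fun x => ‖x‖⁻¹ • x)
      ((volume : Measure (EuclideanSpace ℝ (Fin d))).restrict (Metric.ball 0 1)) := by
  have : Nonempty (Fin d) := ⟨⟨0, hd⟩⟩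
  set μ := (volume : Measure (EuclideanSpace ℝ (Fin d)))
  -- `toSphere` gives `A` the mass `d` times the volume of the open cone over `A`; that cone is the
  -- preimage of `A` in the ball, minus the origin.
  refine ⟨(μ.toSphere univ)⁻¹ * d, ?_⟩
  ext A hA
  have hA' : MeasurableSet
      ((Subtype.val : Metric.sphere (0 : EuclideanSpace ℝ (Fin d)) 1 → _) ⁻¹' A) :=
    measurable_subtype_coe hA
  have hn : Measurable fun x : EuclideanSpace ℝ (Fin d) => ‖x‖⁻¹ • x := by fun_prop
  rw [unifSphere, Measure.map_apply measurable_subtype_coe hA, Measure.smul_apply,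
    Measure.toSphere_apply' _ hA', Measure.smul_apply, Measure.map_apply hn hA,
    Measure.restrict_apply (hn hA), finrank_euclideanSpace_fin, smul_eq_mul, smul_eq_mul, mul_assoc]
  congr 2
  have hset : (Ioo (0 : ℝ) 1 • (Subtype.val '' ((Subtype.val :
        Metric.sphere (0 : EuclideanSpace ℝ (Fin d)) 1 → _) ⁻¹' A))) =
      ((fun x => ‖x‖⁻¹ • x) ⁻¹' A ∩ Metric.ball 0 1) \ {0} := by
    ext x
    simp only [mem_smul, mem_image, mem_preimage, mem_sdiff, mem_inter_iff, mem_singleton_iff,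
      mem_ball_zero_iff]
    constructor
    · rintro ⟨t, ⟨ht0, ht1⟩, _, ⟨y, hy, rfl⟩, rfl⟩
      have hy1 : ‖(y : EuclideanSpace ℝ (Fin d))‖ = 1 := by simp
      have hy0 : (y : EuclideanSpace ℝ (Fin d)) ≠ 0 := norm_ne_zero_iff.1 (by simp [hy1])
      have ht : ‖t • (y : EuclideanSpace ℝ (Fin d))‖ = t := by
        rw [norm_smul, hy1, mul_one, Real.norm_of_nonneg ht0.le]
      rw [ht, smul_smul, inv_mul_cancel₀ ht0.ne', one_smul]
      exact ⟨⟨hy, ht1⟩, smul_ne_zero ht0.ne' hy0⟩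
    · rintro ⟨⟨hxA, hx1⟩, hx0⟩
      have hx : ‖x‖ ≠ 0 := norm_ne_zero_iff.2 hx0
      refine ⟨‖x‖, ⟨norm_pos_iff.2 hx0, hx1⟩, ‖x‖⁻¹ • x, ⟨⟨‖x‖⁻¹ • x, ?_⟩, hxA, rfl⟩, ?_⟩
      · simp [norm_smul, hx]
      · rw [smul_smul, mul_inv_cancel₀ hx, one_smul]
  rw [hset, measure_sdiff_null (measure_singleton _)]

lemma map_linearIsometryEquiv_unifSphere {d : ℕ} (hd : 0 < d)
    (L : EuclideanSpace ℝ (Fin d) ≃ₗᵢ[ℝ] EuclideanSpace ℝ (Fin d)) :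
    Measure.map L (unifSphere d) = unifSphere d := by
  obtain ⟨c, hc⟩ := exists_unifSphere_eq_smul_map d hd
  have hL : Measurable L := L.continuous.measurable
  have hn : Measurable fun x : EuclideanSpace ℝ (Fin d) => ‖x‖⁻¹ • x := by fun_prop
  have hball : L ⁻¹' Metric.ball 0 1 = Metric.ball 0 1 := by ext x; simp
  have hmap : Measure.map L (volume.restrict (Metric.ball 0 1)) =
      volume.restrict (Metric.ball 0 1) := by
    have h := (L.measurePreserving.restrict_preimage
      (s := Metric.ball 0 1) measurableSet_ball).map_eq
    rwa [hball] at h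
  rw [hc, Measure.map_smul, Measure.map_map hL hn]
  have hcomm : (L ∘ fun x => ‖x‖⁻¹ • x) = (fun x => ‖x‖⁻¹ • x) ∘ L := by
    ext1 x
    simp
  rw [hcomm, ← Measure.map_map hn hL, hmap]

/-! ### Block splitting and the Beta law -/

lemma measurePreserving_euclidean_split (ι : Type*) [Fintype ι] (p : ι → Prop) [DecidablePred p] :
    MeasurePreserving (fun x : EuclideanSpace ℝ ι =>
      ((WithLp.toLp 2 fun i => x i, WithLp.toLp 2 fun i => x i) :
        EuclideanSpace ℝ {i // p i} × EuclideanSpace ℝ {i // ¬ p i})) :=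
  ((PiLp.volume_preserving_toLp _).prod (PiLp.volume_preserving_toLp _)).comp
    ((volume_preserving_piEquivPiSubtypeProd (fun _ => ℝ) p).comp (PiLp.volume_preserving_ofLp ι))

lemma exists_map_sum_sq_unifSphere (d r : ℕ) (hr : 0 < r) (hrd : r < d) :
    ∃ c : ℝ≥0∞, Measure.map (fun x : EuclideanSpace ℝ (Fin d) =>
      ∑ i ∈ Finset.univ.filter (fun i : Fin d => (i : ℕ) < r), x i ^ 2) (unifSphere d) =
      c • betaMeasure ((r : ℝ) / 2) (((d : ℝ) - r) / 2) := by
  set p : Fin d → Prop := fun i => (i : ℕ) < r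
  set q : EuclideanSpace ℝ (Fin d) → ℝ := fun x => ∑ i ∈ Finset.univ.filter p, x i ^ 2
  have hq : Measurable q := by fun_prop
  have hn : Measurable fun x : EuclideanSpace ℝ (Fin d) => ‖x‖⁻¹ • x := by fun_prop
  have hcard : Fintype.card {i // p i} = r := by
    rw [Fintype.card_subtype]
    exact Fin.card_filter_val_lt.trans (min_eq_right hrd.le)
  have hcard' : Fintype.card {i // ¬ p i} = d - r := by
    rw [Fintype.card_subtype_compl, hcard, Fintype.card_fin]
  have : Nonempty {i // p i} := Fintype.card_pos_iff.1 (by omega)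
  have : Nonempty {i // ¬ p i} := Fintype.card_pos_iff.1 (by omega)
  obtain ⟨c₀, h₀⟩ := exists_unifSphere_eq_smul_map d (by omega)
  obtain ⟨c₁, h₁⟩ := exists_lintegral_norm_sq (EuclideanSpace ℝ {i // p i})
  obtain ⟨c₂, h₂⟩ := exists_lintegral_norm_sq (EuclideanSpace ℝ {i // ¬ p i})
  rw [finrank_euclideanSpace, hcard] at h₁
  rw [finrank_euclideanSpace, hcard', Nat.cast_sub hrd.le] at h₂
  set a : ℝ := (r : ℝ) / 2
  set b : ℝ := ((d : ℝ) - r) / 2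
  have ha : 0 < a := by positivity
  have hb : 0 < b := half_pos (sub_pos.2 (by exact_mod_cast hrd))
  have hpa := measurable_posPow (a - 1)
  have hpb := measurable_posPow (b - 1)
  -- The unit ball as a condition on the squared norm.
  set W : ℝ → ℝ≥0∞ := indicator (Iio 1) 1
  have hW : Measurable W := measurable_one.indicator measurableSet_Iio
  set C : ℝ≥0∞ := ∫⁻ s, W s * (ENNReal.ofReal s * posPow (a - 1) s * posPow (b - 1) s)
  set K : ℝ≥0∞ := ENNReal.ofReal (1 / beta a b)
  have hK : K ≠ 0 := (ENNReal.ofReal_pos.2 (one_div_pos.2 (beta_pos ha hb))).ne'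
  -- `K⁻¹` cancels the normalization of `betaMeasure`.
  refine ⟨c₀ * (c₁ * (c₂ * C)) * K⁻¹, ?_⟩
  rw [betaMeasure_eq_smul a b ha hb, smul_smul, mul_assoc,
    ENNReal.inv_mul_cancel hK ENNReal.ofReal_ne_top, mul_one]
  ext S hS
  set F : ℝ → ℝ≥0∞ := indicator S 1
  have hF : Measurable F := measurable_one.indicator hS
  have hsplit (x : EuclideanSpace ℝ (Fin d)) :
      q x = ‖(WithLp.toLp 2 fun i => x i : EuclideanSpace ℝ {i // p i})‖ ^ 2 := by
    rw [EuclideanSpace.real_norm_sq_eq]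
    exact (Finset.sum_subtype (Finset.univ.filter p) (by simp) fun i => x i ^ 2)
  have hnorm (x : EuclideanSpace ℝ (Fin d)) :
      ‖x‖ ^ 2 = ‖(WithLp.toLp 2 fun i => x i : EuclideanSpace ℝ {i // p i})‖ ^ 2 +
        ‖(WithLp.toLp 2 fun i => x i : EuclideanSpace ℝ {i // ¬ p i})‖ ^ 2 := by
    simp only [EuclideanSpace.real_norm_sq_eq]
    exact (Fintype.sum_subtype_add_sum_subtype p fun i => x i ^ 2).symm
  have hqn (x : EuclideanSpace ℝ (Fin d)) : q (‖x‖⁻¹ • x) = q x / ‖x‖ ^ 2 := by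
    simp only [q, PiLp.smul_apply, smul_eq_mul, mul_pow, ← Finset.mul_sum]
    rw [inv_pow, mul_comm, div_eq_mul_inv]
  have hball (x : EuclideanSpace ℝ (Fin d)) :
      (Metric.ball 0 1).indicator (1 : EuclideanSpace ℝ (Fin d) → ℝ≥0∞) x = W (‖x‖ ^ 2) := by
    simp [W, indicator]
  have hvol : volume ((fun x : EuclideanSpace ℝ (Fin d) => q (‖x‖⁻¹ • x)) ⁻¹' S ∩
      Metric.ball 0 1) = ∫⁻ x : EuclideanSpace ℝ (Fin d), W (‖x‖ ^ 2) * F (q x / ‖x‖ ^ 2) := by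
    have hm : MeasurableSet ((fun x : EuclideanSpace ℝ (Fin d) => q (‖x‖⁻¹ • x)) ⁻¹' S ∩
      Metric.ball 0 1) := (hq.comp hn hS).inter measurableSet_ball
    rw [← lintegral_indicator_one hm]
    refine lintegral_congr fun x => ?_
    rw [← hball, ← hqn, mul_comm, Set.inter_indicator_one]
    rfl
  rw [h₀, Measure.map_smul, Measure.map_map hq hn, Measure.smul_apply,
    Measure.map_apply (hq.comp hn) hS, Measure.restrict_apply (hq.comp hn hS)]
  change c₀ • volume ((fun x : EuclideanSpace ℝ (Fin d) => q (‖x‖⁻¹ • x)) ⁻¹' S ∩ _) = _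
  rw [hvol, Measure.smul_apply, withDensity_apply _ hS, smul_eq_mul, smul_eq_mul, mul_assoc c₀]
  congr 1
  calc
    _ = ∫⁻ z : EuclideanSpace ℝ {i // p i} × EuclideanSpace ℝ {i // ¬ p i},
        W (‖z.1‖ ^ 2 + ‖z.2‖ ^ 2) * F (‖z.1‖ ^ 2 / (‖z.1‖ ^ 2 + ‖z.2‖ ^ 2)) := by
      rw [← (measurePreserving_euclidean_split (Fin d) p).lintegral_comp (by fun_prop)]
      simp only [hnorm, hsplit]
    _ = ∫⁻ x : EuclideanSpace ℝ {i // p i}, c₂ * ∫⁻ v, posPow (b - 1) v *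
        (W (‖x‖ ^ 2 + v) * F (‖x‖ ^ 2 / (‖x‖ ^ 2 + v))) := by
      rw [Measure.volume_eq_prod, lintegral_prod _ (by fun_prop)]
      exact lintegral_congr fun x =>
        h₂ (fun v => W (‖x‖ ^ 2 + v) * F (‖x‖ ^ 2 / (‖x‖ ^ 2 + v))) (by fun_prop)
    _ = c₁ * ∫⁻ u, posPow (a - 1) u * (c₂ * ∫⁻ v, posPow (b - 1) v *
        (W (u + v) * F (u / (u + v)))) :=
      h₁ (fun u => c₂ * ∫⁻ v, posPow (b - 1) v * (W (u + v) * F (u / (u + v)))) (by fun_prop)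
    _ = c₁ * (c₂ * ∫⁻ u, ∫⁻ v, posPow (a - 1) u * posPow (b - 1) v *
        (W (u + v) * F (u / (u + v)))) := by
      congr 1
      rw [← lintegral_const_mul _ (by fun_prop)]
      refine lintegral_congr fun u => ?_
      rw [mul_left_comm, ← lintegral_const_mul _ (by fun_prop)]
      simp only [mul_assoc]
    _ = c₁ * (c₂ * C) * ∫⁻ t, posPow (a - 1) t * posPow (b - 1) (1 - t) * F t := by
      rw [lintegral_lintegral_posPow _ _ hW hF, mul_assoc, mul_assoc]
    _ = _ := by
      congr 1
      rw [← lintegral_indicator hS]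
      refine lintegral_congr fun t => ?_
      by_cases ht : t ∈ S <;> simp [F, ht]

/-! ### Eigenbasis coordinates and conclusion -/

lemma exists_orthonormalBasis_col {d : ℕ} {U : Matrix (Fin d) (Fin d) ℝ}
    (hU : U ∈ Matrix.orthogonalGroup (Fin d) ℝ) :
    ∃ b : OrthonormalBasis (Fin d) ℝ (EuclideanSpace ℝ (Fin d)),
      (∀ i, b i = WithLp.toLp 2 (U.col i)) ∧ ∀ x, rotated U x = b.repr x := by
  have hon : Orthonormal ℝ fun i => (WithLp.toLp 2 (U.col i) : EuclideanSpace ℝ (Fin d)) := by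
    rw [orthonormal_iff_ite]
    intro i j
    have h := congrFun (congrFun ((Matrix.mem_orthogonalGroup_iff' _ _).1 hU) i) j
    rw [Matrix.one_apply] at h
    rw [← h]
    simp [PiLp.inner_apply, Matrix.mul_apply, mul_comm]
  refine ⟨OrthonormalBasis.mk hon
    (hon.linearIndependent.span_eq_top_of_card_eq_finrank' (by simp)).ge, fun i => by simp,
    fun x => ?_⟩
  ext i
  rw [OrthonormalBasis.repr_apply_apply, OrthonormalBasis.coe_mk]
  simp [rotated, PiLp.inner_apply, Matrix.mulVec, dotProduct, mul_comm]

lemma OrthonormalBasis.norm_starProjection_span_image_sq {ι E : Type*} [Fintype ι]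
    [NormedAddCommGroup E] [InnerProductSpace ℝ E] [FiniteDimensional ℝ E]
    (b : OrthonormalBasis ι ℝ E) (t : Finset ι) (x : E) :
    ‖(Submodule.span ℝ (b '' t)).starProjection x‖ ^ 2 = ∑ i ∈ t, b.repr x i ^ 2 := by
  classical
  have hproj : (Submodule.span ℝ (b '' t)).starProjection x = ∑ i ∈ t, b.repr x i • b i := by
    refine Submodule.eq_starProjection_of_mem_orthogonal
      (Submodule.sum_mem _ fun i hi =>
        Submodule.smul_mem _ _ (Submodule.subset_span (mem_image_of_mem _ hi))) ?_
    rw [Submodule.mem_orthogonal]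
    intro u hu
    induction hu using Submodule.span_induction with
    | mem y hy =>
      obtain ⟨j, hj, rfl⟩ := hy
      rw [inner_sub_right, b.orthonormal.inner_right_sum _ hj, b.repr_apply_apply, sub_self]
    | zero => simp
    | add y z _ _ hy hz => rw [inner_add_left, hy, hz, add_zero]
    | smul a y _ hy => rw [inner_smul_left, hy, mul_zero]
  rw [hproj, ← real_inner_self_eq_norm_sq, b.orthonormal.inner_sum]
  simp [sq]

lemma quadForm_eq_sum_rotated {d : ℕ} (U : Matrix (Fin d) (Fin d) ℝ) (lam : Fin d → ℝ)
    (x : EuclideanSpace ℝ (Fin d)) :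
    quadForm (U * Matrix.diagonal lam * Uᵀ) x = ∑ i, lam i * rotated U x i ^ 2 := by
  rw [quadForm, ← Matrix.mulVec_mulVec, ← Matrix.mulVec_mulVec, Matrix.dotProduct_mulVec,
    ← Matrix.mulVec_transpose]
  simp only [rotated, dotProduct, Matrix.mulVec_diagonal]
  exact Finset.sum_congr rfl fun i _ => by ring

lemma Matrix.PosSemidef.nonneg_of_eq_mul_diagonal_mul {d : ℕ} {G U : Matrix (Fin d) (Fin d) ℝ}
    {lam : Fin d → ℝ} (hG : G.PosSemidef) (hU : U ∈ Matrix.orthogonalGroup (Fin d) ℝ)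
    (hspec : G = U * Matrix.diagonal lam * Uᵀ) (i : Fin d) : 0 ≤ lam i := by
  have hUU : Uᵀ * U = 1 := (Matrix.mem_orthogonalGroup_iff' _ _).1 hU
  have h := hG.conjTranspose_mul_mul_same U
  rw [hspec, Matrix.conjTranspose_eq_transpose_of_trivial, ← Matrix.mul_assoc, ← Matrix.mul_assoc,
    hUU, Matrix.one_mul, Matrix.mul_assoc, hUU, Matrix.mul_one, Matrix.posSemidef_diagonal_iff] at h
  exact h i

lemma ProbabilityTheory.HasLaw.sum_sq_unifSphere {Ω : Type*} [MeasurableSpace Ω] {P : Measure Ω}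
    [IsProbabilityMeasure P] {d r : ℕ} (hr : 0 < r) (hrd : r < d)
    {Y : Ω → EuclideanSpace ℝ (Fin d)} (hY : HasLaw Y (unifSphere d) P) :
    HasLaw (fun ω => ∑ i ∈ Finset.univ.filter (fun i : Fin d => (i : ℕ) < r), Y ω i ^ 2)
      (betaMeasure ((r : ℝ) / 2) (((d : ℝ) - r) / 2)) P := by
  obtain ⟨c, hc⟩ := exists_map_sum_sq_unifSphere d r hr hrd
  have hq : Measurable fun x : EuclideanSpace ℝ (Fin d) =>
    ∑ i ∈ Finset.univ.filter (fun i : Fin d => (i : ℕ) < r), x i ^ 2 := by fun_prop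
  have hqY := hq.comp_aemeasurable hY.aemeasurable
  have hmap : P.map (fun ω => ∑ i ∈ Finset.univ.filter (fun i : Fin d => (i : ℕ) < r), Y ω i ^ 2) =
      c • betaMeasure ((r : ℝ) / 2) (((d : ℝ) - r) / 2) := by
    rw [← hc, ← hY.map_eq, AEMeasurable.map_map_of_aemeasurable hq.aemeasurable hY.aemeasurable]
    rfl
  have : IsProbabilityMeasure (betaMeasure ((r : ℝ) / 2) (((d : ℝ) - r) / 2)) :=
    isProbabilityMeasureBeta (by positivity) (half_pos (sub_pos.2 (by exact_mod_cast hrd)))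
  -- Both sides of `hmap` are evaluated on the whole line.
  have hc1 : c = 1 := by
    have h := congrArg (fun μ : Measure ℝ => μ univ) hmap
    have hprob := Measure.isProbabilityMeasure_map hqY
    simpa using h.symm.trans hprob.measure_univ
  exact ⟨hqY, by rw [hmap, hc1, one_smul]⟩

theorem proposition2 {Ω : Type*} [MeasurableSpace Ω] (P : Measure Ω) [IsProbabilityMeasure P]
    (d r : ℕ) (hr : 1 ≤ r) (hrd : r < d)
    (G U : Matrix (Fin d) (Fin d) ℝ) (lam : Fin d → ℝ)
    (hG : G.PosSemidef) (hU : U ∈ Matrix.orthogonalGroup (Fin d) ℝ)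
    (hspec : G = U * Matrix.diagonal lam * Uᵀ) (hlam : Antitone lam)
    (s : Ω → EuclideanSpace ℝ (Fin d)) (hs : HasLaw s (unifSphere d) P) :
    (∀ ω, quadForm G (s ω) = ∑ i, lam i * (rotated U (s ω) i) ^ 2) ∧
    HasLaw (fun ω => rotated U (s ω)) (unifSphere d) P ∧
    (∀ ω, ‖(leadingSpan U r).starProjection (s ω)‖ ^ 2 =
      ∑ i ∈ Finset.univ.filter (fun i : Fin d => (i : ℕ) < r), (rotated U (s ω) i) ^ 2) ∧
    HasLaw (fun ω => ∑ i ∈ Finset.univ.filter (fun i : Fin d => (i : ℕ) < r), (rotated U (s ω) i) ^ 2)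
      (betaMeasure ((r : ℝ) / 2) (((d : ℝ) - r) / 2)) P ∧
    (∀ ε δ : ℝ, 0 ≤ ε → 0 ≤ δ →
      1 - δ ≤ P.real {ω | ∑ i ∈ Finset.univ.filter (fun i : Fin d => r ≤ (i : ℕ)), lam i * (rotated U (s ω) i) ^ 2 ≤
        ε * ∑ i ∈ Finset.univ.filter (fun i : Fin d => (i : ℕ) < r), lam i * (rotated U (s ω) i) ^ 2} →
      1 - δ ≤ P.real {ω | |quadForm G (s ω) -
          ∑ i ∈ Finset.univ.filter (fun i : Fin d => (i : ℕ) < r), lam i * (rotated U (s ω) i) ^ 2| ≤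
        ε * ∑ i ∈ Finset.univ.filter (fun i : Fin d => (i : ℕ) < r), lam i * (rotated U (s ω) i) ^ 2}) := by
  obtain ⟨b, hb, hrot⟩ := exists_orthonormalBasis_col hU
  have hquad : ∀ ω, quadForm G (s ω) = ∑ i, lam i * (rotated U (s ω) i) ^ 2 := fun ω => by
    rw [hspec, quadForm_eq_sum_rotated]
  have hY : HasLaw (fun ω => rotated U (s ω)) (unifSphere d) P := by
    simp only [hrot]
    have hm : Measurable b.repr := b.repr.continuous.measurable
    refine ⟨hm.comp_aemeasurable hs.aemeasurable, ?_⟩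
    rw [← map_linearIsometryEquiv_unifSphere (by omega) b.repr, ← hs.map_eq,
      AEMeasurable.map_map_of_aemeasurable hm.aemeasurable hs.aemeasurable]
    rfl
  refine ⟨hquad, hY, fun ω => ?_, hY.sum_sq_unifSphere hr hrd, fun ε δ _ _ h => ?_⟩
  · rw [hrot, ← b.norm_starProjection_span_image_sq]
    simp [leadingSpan, hb]
  · refine h.trans (measureReal_mono fun ω hω => ?_)
    have hsplit := Finset.sum_filter_add_sum_filter_not Finset.univ (fun i : Fin d => (i : ℕ) < r)
      fun i => lam i * (rotated U (s ω) i) ^ 2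
    simp only [not_lt] at hsplit
    have hnonneg : 0 ≤ ∑ i ∈ Finset.univ.filter (fun i : Fin d => r ≤ (i : ℕ)),
        lam i * (rotated U (s ω) i) ^ 2 :=
      Finset.sum_nonneg fun i _ =>
        mul_nonneg (hG.nonneg_of_eq_mul_diagonal_mul hU hspec i) (sq_nonneg _)
    rw [mem_ofPred_eq] at hω ⊢
    rwa [hquad, ← hsplit, add_sub_cancel_left, abs_of_nonneg hnonneg]
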